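/- Let $(E,e,T)$ be a conditional Riesz triple: $E$ is a Dedekind complete Riesz space, $e$ is a weak order unit of $E$, and $T$ is a conditional expectation operator on $E$, that is, a strictly positive, order continuous linear projection with $Te=e$ whose range $R(T)$ is a Dedekind complete Riesz subspace of $E$. Let $(P_j)_{j\ge 1}$ be a Bernoulli process with $TP_je=f$ for all $j$, for some $f\in E$; that is, a sequence of band projections on $E$ such that $TP_je=f$ for all $j$ and which is $T$-independent: $$TP_{\alpha_1}P_{\alpha_2}\cdots P_{\alpha_m}e=TP_{\alpha_1}TP_{\alpha_2}\cdots TP_{\alpha_m}e$$ for all finitely many distinct indices $\alpha_1,\dots,\alpha_m$. Put $S_n=\sum_{k=1}^n P_ke$ and $$\|f\|_e=\inf\{\beta\in\mathbb R:\ |f|\le\beta e\}.$$ Then, for every $n$ and every real $t>n\|f\|_e$, $$TP_{(S_n-te)^+}e\ \le\ \left(\frac{n\|f\|_e\exp(1)}{t}\right)^{t}\exp(-nf).$$ Here $P_u$ denotes the projection onto the band generated by $u$, and $\exp(-nf)\in E$ is given by the Daniell functional calculus: for $x\in E$ with spectral system $e^x_r=e-P_{(x-re)^+}e$ ($r\in\mathbb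 R$), $e^x_{-\infty}=0$, $e^x_{\infty}=e$, one sets $I_x(\varphi)=\sum_i c_i(e^x_{b_i}-e^x_{a_i})$ for a step function $\varphi=\sum_i c_i\mathbf 1_{(a_i,b_i]\cap\mathbb R}$ with finitely many disjoint intervals, $-\infty\le a_i\le b_i\le\infty$; for a function $g$ that is the pointwise limit of an increasing sequence of step functions, $g(x)=I_x(g)$ is the supremum of $I_x(\varphi)$ over all step functions $\varphi\le g$ (equivalently $\sup_m I_x(\varphi_m)$ for any step functions $\varphi_m\uparrow g$), if this supremum exists in $E$. That $\exp(-nf)$ exists in $E$ is part of the claim. -/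

import Mathlib

open scoped Topology

noncomputable section

/-! Throughout, a Dedekind complete Riesz space is a real vector space `E` with
`[ConditionallyCompleteLattice E] [IsOrderedAddMonoid E] [IsOrderedModule ℝ E]`. -/

namespace RieszSpace

variable {E : Type*} [AddCommGroup E] [Module ℝ E] [ConditionallyCompleteLattice E]

/-- `e` is a weak order unit: `e ≥ 0` and the only element disjoint from `e` is `0`. -/
structure IsWeakOrderUnit (e : E) : Prop where
  nonneg : 0 ≤ e
  eq_zero_of_disjoint : ∀ x : E, e ⊓ |x| = 0 → x = 0

/-- `(E, e, T)` is a conditional Riesz triple: `e` is a weak order unit and `T` is a strictly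
positive conditional expectation, i.e. a strictly positive order continuous linear projection with
`T e = e` whose range is a Dedekind complete Riesz subspace of `E`.  (A positive operator is order
continuous iff `x_α ↓ 0` implies `T x_α ↓ 0`.) -/
structure IsConditionalTriple (e : E) (T : Module.End ℝ E) : Prop where
  weakUnit : IsWeakOrderUnit e
  positive : ∀ x : E, 0 ≤ x → 0 ≤ T x
  strictlyPositive : ∀ x : E, 0 < x → 0 < T x
  projection : ∀ x : E, T (T x) = T x
  map_unit : T e = e
  orderContinuous : ∀ D : Set E, D.Nonempty → DirectedOn (fun x y => y ≤ x) D →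
    IsGLB D 0 → IsGLB (T '' D) 0
  range_sup : ∀ x ∈ LinearMap.range T, ∀ y ∈ LinearMap.range T, x ⊔ y ∈ LinearMap.range T
  range_complete : ∀ D : Set (LinearMap.range T), D.Nonempty → BddAbove D → ∃ a, IsLUB D a

/-- A band: a solid linear subspace closed under all suprema that exist in `E`. -/
structure IsBand (B : Submodule ℝ E) : Prop where
  solid : ∀ x ∈ B, ∀ y : E, |y| ≤ |x| → y ∈ B
  sup_mem : ∀ D : Set E, D ⊆ B → ∀ a : E, IsLUB D a → a ∈ B

/-- `P` is a band projection: for some band `B` with `E = B ⊕ Bᵈ`, `P` is the projection onto `B`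
along the disjoint complement `Bᵈ`. -/
def IsBandProjection (P : Module.End ℝ E) : Prop :=
  ∃ B : Submodule ℝ E, IsBand B ∧ ∀ x : E, P x ∈ B ∧ ∀ b ∈ B, |x - P x| ⊓ |b| = 0

/-- The projection `P_u x` of `x` onto the band generated by `u`:
`P_u x = sup_n (x ∧ n|u|)` for `x ≥ 0`, and `P_u x = P_u x⁺ - P_u x⁻` in general. -/
def bandProj (u x : E) : E :=
  (⨆ n : ℕ, x⁺ ⊓ (n : ℝ) • |u|) - ⨆ n : ℕ, x⁻ ⊓ (n : ℝ) • |u|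

/-- `T`-independence of a family of band projections:
`T P_{α₁} P_{α₂} ⋯ P_{αₙ} e = T P_{α₁} T P_{α₂} ⋯ T P_{αₙ} e`
for all finitely many distinct indices `α₁, …, αₙ`. -/
def TIndependent {ι : Type*} (e : E) (T : Module.End ℝ E) (P : ι → Module.End ℝ E) : Prop :=
  ∀ l : List ι, l.Nodup →
    T ((l.map P).prod e) = (l.map fun i => T * P i).prod e

/-- `(P_j)` is a Bernoulli process with `T P_j e = f` for all `j`: a `T`-independent sequence of
band projections with this property. -/
structure IsBernoulliProcess (e : E) (T : Module.End ℝ E) (P : ℕ → Module.End ℝ E) (f : E) :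
    Prop where
  bandProjection : ∀ j, IsBandProjection (P j)
  independent : TIndependent e T P
  expectation : ∀ j, T (P j e) = f

/-- The order unit norm `‖f‖_e = inf {β ∈ ℝ : |f| ≤ β e}`. -/
def unitNorm (e f : E) : ℝ := sInf {β : ℝ | |f| ≤ β • e}

/-- The right continuous spectral system `e_r = P_{x ≤ r e} e = e - P_{(x - r e)⁺} e` of `x`,
extended by `e_{-∞} = 0` and `e_{∞} = e`. -/
def spectralSystem (e x : E) (r : EReal) : E :=
  if r = ⊥ then 0 else if r = ⊤ then e else e - bandProj (x - r.toReal • e)⁺ e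

end RieszSpace

/-- A step function on `ℝ` over the algebra of finite unions of intervals `(a, b]`, `(-∞, b]`,
`(a, ∞)`: it takes the value `c i` on `(t i, t (i + 1)] ∩ ℝ`, where
`-∞ = t 0 ≤ t 1 ≤ ⋯ ≤ t N = ∞`. -/
structure DaniellStep where
  N : ℕ
  t : ℕ → EReal
  c : ℕ → ℝ
  mono : Monotone t
  t_zero : t 0 = ⊥
  t_last : t N = ⊤

namespace DaniellStep

open Classical in
/-- The step function as a function on `ℝ`. -/
def eval (φ : DaniellStep) (s : ℝ) : ℝ :=
  ∑ i ∈ Finset.range φ.N, if φ.t i < (s : EReal) ∧ (s : EReal) ≤ φ.t (i + 1) then φ.c i else 0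

variable {E : Type*} [AddCommGroup E] [Module ℝ E] [ConditionallyCompleteLattice E]

/-- `I_x φ`, the integral of a step function with respect to the spectral system of `x`; the
interval `(a, b]` has measure `e_b - e_a`. -/
def integral (e x : E) (φ : DaniellStep) : E :=
  ∑ i ∈ Finset.range φ.N,
    φ.c i • (RieszSpace.spectralSystem e x (φ.t (i + 1)) - RieszSpace.spectralSystem e x (φ.t i))

end DaniellStep

namespace RieszSpace

variable {E : Type*} [AddCommGroup E] [Module ℝ E] [ConditionallyCompleteLattice E]

/-- `g ∈ L^↑`: `g` is the pointwise limit of an increasing sequence of step functions. -/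
def IsUpperLimit (g : ℝ → ℝ) : Prop :=
  ∃ φ : ℕ → DaniellStep, (∀ s, Monotone fun m => (φ m).eval s) ∧
    ∀ s, Filter.Tendsto (fun m => (φ m).eval s) Filter.atTop (𝓝 (g s))

/-- `y = g(x)` in the Daniell functional calculus, for `g ∈ L^↑` (with value in `E`): `y` is the
Daniell integral `I_x(g)`.  For `g ∈ L^↑` all increasing sequences of step functions `φ_m ↑ g` give
the same `sup_m I_x(φ_m)`, and it is the supremum of `I_x(φ)` over all step functions `φ ≤ g`. -/
def IsFunctionalCalculus (e x : E) (g : ℝ → ℝ) (y : E) : Prop :=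
  IsUpperLimit g ∧ IsLUB {z : E | ∃ φ : DaniellStep, (∀ s, φ.eval s ≤ g s) ∧ φ.integral e x = z} y

end RieszSpace

end

set_option linter.unusedSectionVars false

/-! This is Chernoff's argument with the exponential moment of `S_n` replaced by a product of
operators. Order projections commute, and splitting along each `P_k` shows, for `θ ≥ 0`, that
`exp(θt) P_{(S_n - te)⁺} e ≤ ∏ (1 + (exp θ - 1) P_k) e` (`exp_smul_le_prodOneAdd`,
`bandProj_le_exp_smul_prodOneAdd`). With `b = ‖f‖_e` and `f ≤ b e`, independence bounds `T` of the
right side by `(1 + (exp θ - 1) b)^n e` (`apply_prodOneAdd_le`), hence by `exp(nb(exp θ - 1)) e`.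

Taking `θ = log (t / (nb))` gives `(nb exp(1) / t)^t exp(-nb) e`. Since `-nb e ≤ -nf ≤ 0`, the
element `exp(-nf)` exists and dominates `exp(-nb) e` (`exists_isFunctionalCalculus_exp`). Replacing
`f` by `b e` before exponentiating avoids any product or averaging rule for `T`. -/

namespace RieszSpace

/-! ### Archimedean property and order projections -/

section OrderedModule

variable {E : Type*} [AddCommGroup E] [Module ℝ E] [ConditionallyCompleteLattice E]
  [IsOrderedAddMonoid E] [IsOrderedModule ℝ E]

/-- A Dedekind complete Riesz space is Archimedean. -/
theorem nonpos_of_forall_le_smul {x e : E} (h : ∀ ε : ℝ, 0 < ε → x ≤ ε • e) : x ≤ 0 := by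
  have hb : BddAbove (Set.range fun n : ℕ => ((n : ℝ) + 1) • x) := by
    refine ⟨e, ?_⟩
    rintro _ ⟨n, rfl⟩
    have hn : (0 : ℝ) < (n : ℝ) + 1 := by positivity
    have := smul_le_smul_of_nonneg_left (h _ (inv_pos.2 hn)) hn.le
    rwa [smul_smul, mul_inv_cancel₀ hn.ne', one_smul] at this
  -- The shifted multiples `(n + 2) x` have the same upper bound.
  have hs : (⨆ n : ℕ, ((n : ℝ) + 1) • x) ≤ (⨆ n : ℕ, ((n : ℝ) + 1) • x) - x := by
    refine ciSup_le fun n => ?_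
    have := le_ciSup hb (n + 1)
    rw [le_sub_iff_add_le]
    refine le_trans (le_of_eq ?_) this
    push_cast
    module
  simpa using hs

theorem le_of_forall_le_add_smul {x y e : E} (h : ∀ ε : ℝ, 0 < ε → x ≤ y + ε • e) : x ≤ y := by
  rw [← sub_nonpos]
  exact nonpos_of_forall_le_smul fun ε hε => sub_le_iff_le_add'.2 (h ε hε)

/-- A linear map `P` with `P² = P` and `0 ≤ P ≤ 1`. -/
structure IsOrderProjection (P : Module.End ℝ E) : Prop where
  idem : ∀ x, P (P x) = P x
  nonneg : ∀ x, 0 ≤ x → 0 ≤ P x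
  le_self : ∀ x, 0 ≤ x → P x ≤ x

/-- From `-p ≤ q`, the negative part `p⁻` lies below both `|q|` and `|p|`, which are disjoint. -/
theorem nonneg_of_disjoint_of_add_nonneg {p q : E} (hd : |p| ⊓ |q| = 0) (h : 0 ≤ p + q) :
    0 ≤ p := by
  have h1 : p⁻ ≤ |q| := by
    rw [negPart_def]
    exact sup_le ((neg_le_iff_add_nonneg'.2 h).trans (le_abs_self q)) (abs_nonneg q)
  have h2 : p⁻ ≤ |p| := by
    rw [negPart_def]
    exact sup_le (neg_le_abs p) (abs_nonneg p)
  exact negPart_eq_zero.1 (le_antisymm ((le_inf h2 h1).trans hd.le) (negPart_nonneg p))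

theorem IsBandProjection.isOrderProjection {P : Module.End ℝ E} (hP : IsBandProjection P) :
    IsOrderProjection P := by
  obtain ⟨B, -, hPB⟩ := hP
  refine ⟨fun x => ?_, fun x hx => ?_, fun x hx => ?_⟩
  -- `P x - P (P x)` lies in the band and is disjoint from it, hence from itself.
  · have h := (hPB (P x)).2 _ (B.sub_mem (hPB x).1 (hPB (P x)).1)
    rw [inf_idem] at h
    have hle := (le_abs_self _).trans_eq h
    have hge := (neg_le_abs _).trans_eq h
    exact (sub_eq_zero.1 (le_antisymm hle (neg_nonpos.1 hge))).symm
  · refine nonneg_of_disjoint_of_add_nonneg (q := x - P x) ?_ (by simpa using hx)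
    rw [inf_comm]
    exact (hPB x).2 _ (hPB x).1
  · rw [← sub_nonneg]
    exact nonneg_of_disjoint_of_add_nonneg ((hPB x).2 _ (hPB x).1) (by simpa using hx)

theorem end_ext_of_nonneg {A B : Module.End ℝ E} (h : ∀ x, 0 ≤ x → A x = B x) (x : E) :
    A x = B x := by
  rw [← posPart_sub_negPart x, map_sub, map_sub, h _ (posPart_nonneg x), h _ (negPart_nonneg x)]

theorem monotone_of_nonneg {A : Module.End ℝ E} (hA : ∀ x, 0 ≤ x → 0 ≤ A x) : Monotone A := by
  intro x y hxy
  rw [← sub_nonneg, ← map_sub]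
  exact hA _ (sub_nonneg.2 hxy)

namespace IsOrderProjection

variable {P Q : Module.End ℝ E}

theorem monotone (hP : IsOrderProjection P) : Monotone P := monotone_of_nonneg hP.nonneg

theorem one_sub (hP : IsOrderProjection P) : IsOrderProjection (1 - P) where
  idem x := by simp [hP.idem]
  nonneg x hx := by simpa using hP.le_self x hx
  le_self x hx := by simpa using hP.nonneg x hx

/-- Since `P ≤ 1`, the images of `x⁺` and `x⁻` stay disjoint, and a difference of disjoint positive
elements has the first as its positive part. -/
theorem map_posPart (hP : IsOrderProjection P) (x : E) : P x⁺ = (P x)⁺ := by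
  have hd : P x⁺ ⊓ P x⁻ = 0 := by
    refine le_antisymm ?_ (le_inf (hP.nonneg _ (posPart_nonneg x)) (hP.nonneg _ (negPart_nonneg x)))
    rw [← posPart_inf_negPart_eq_zero x]
    exact inf_le_inf (hP.le_self _ (posPart_nonneg x)) (hP.le_self _ (negPart_nonneg x))
  have hx : P x = P x⁺ - P x⁻ := by rw [← map_sub, posPart_sub_negPart]
  have h := inf_add_sup (P x⁺) (P x⁻)
  rw [hd, zero_add] at h
  have h0 := sup_sub (P x⁺) (P x⁻) (P x⁻)
  rw [h, sub_self, add_sub_cancel_right] at h0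
  rw [hx, posPart_def]
  exact h0

/-- Both `PQ` and `QP` equal `QPQ`: on the positive cone, `0 ≤ P ≤ 1` forces `(1 - Q)PQ = 0` and
`QP(1 - Q) = 0`. -/
theorem apply_comm (hP : IsOrderProjection P) (hQ : IsOrderProjection Q) (x : E) :
    P (Q x) = Q (P x) := by
  have h1 (y : E) : Q (P (Q y)) = P (Q y) := by
    refine end_ext_of_nonneg (A := Q * P * Q) (B := P * Q) (fun x hx => ?_) y
    have hQx := hQ.nonneg x hx
    have hle := hQ.one_sub.monotone (hP.le_self _ hQx)
    simp only [LinearMap.sub_apply, Module.End.one_apply, hQ.idem, sub_self, sub_nonpos] at hle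
    exact le_antisymm (hQ.le_self _ (hP.nonneg _ hQx)) hle
  have h2 (y : E) : Q (P (Q y)) = Q (P y) := by
    refine end_ext_of_nonneg (A := Q * P * Q) (B := Q * P) (fun x hx => ?_) y
    have hRx := hQ.one_sub.nonneg x hx
    have hle := hQ.monotone (hP.le_self _ hRx)
    have hge := hQ.nonneg _ (hP.nonneg _ hRx)
    simp only [LinearMap.sub_apply, Module.End.one_apply, map_sub, hQ.idem, sub_self] at hle hge
    exact (sub_eq_zero.1 (le_antisymm hle hge)).symm
  rw [← h1, h2]

end IsOrderProjection

/-! ### Exponential Markov inequality -/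

/-- The operator `∏_{k < n} (1 + a P_k)`. -/
noncomputable def prodOneAdd (P : ℕ → Module.End ℝ E) (a : ℝ) : ℕ → Module.End ℝ E
  | 0 => 1
  | n + 1 => (1 + a • P n) * prodOneAdd P a n

section prodOneAdd

variable {P : ℕ → Module.End ℝ E} {a : ℝ}

theorem prodOneAdd_succ_apply (n : ℕ) (x : E) :
    prodOneAdd P a (n + 1) x = prodOneAdd P a n x + a • P n (prodOneAdd P a n x) := by
  simp [prodOneAdd]

theorem prodOneAdd_nonneg (hP : ∀ j, IsOrderProjection (P j)) (ha : 0 ≤ a) (n : ℕ) {x : E}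
    (hx : 0 ≤ x) : 0 ≤ prodOneAdd P a n x := by
  induction n with
  | zero => simpa [prodOneAdd] using hx
  | succ n ih =>
    rw [prodOneAdd_succ_apply]
    exact add_nonneg ih (smul_nonneg ha ((hP n).nonneg _ ih))

theorem apply_prodOneAdd_comm (hP : ∀ j, IsOrderProjection (P j)) (j n : ℕ) (x : E) :
    P j (prodOneAdd P a n x) = prodOneAdd P a n (P j x) := by
  induction n with
  | zero => simp [prodOneAdd]
  | succ n ih =>
    rw [prodOneAdd_succ_apply, prodOneAdd_succ_apply, map_add, map_smul, (hP j).apply_comm (hP n),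
      ih]

/-- The pointwise exponential Markov inequality for a sum of commuting projections. -/
theorem exp_smul_le_prodOneAdd (hP : ∀ j, IsOrderProjection (P j)) {θ : ℝ} (hθ : 0 ≤ θ) (n : ℕ)
    {m t : ℝ} {x y : E} (hx : 0 ≤ x)
    (hxy : x ≤ m • (∑ k ∈ Finset.range n, P k y - t • y)⁺) (hy : 0 ≤ y) :
    Real.exp (θ * t) • x ≤ prodOneAdd P (Real.exp θ - 1) n x := by
  induction n generalizing t x y with
  | zero =>
    -- The sum is empty: for `t ≤ 0` the exponential is at most `1`, and for `t ≥ 0` the positive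
    -- part vanishes, so `x = 0`.
    rcases le_total t 0 with ht | ht
    · calc Real.exp (θ * t) • x ≤ (1 : ℝ) • x :=
            smul_le_smul_of_nonneg_right
              (Real.exp_le_one_iff.2 (mul_nonpos_of_nonneg_of_nonpos hθ ht)) hx
        _ = _ := by simp [prodOneAdd]
    · have h0 : (∑ k ∈ Finset.range 0, P k y - t • y)⁺ = 0 := by
        rw [posPart_eq_zero]
        simpa using smul_nonneg ht hy
      rw [h0, smul_zero] at hxy
      simp [le_antisymm hxy hx]
  | succ n ih =>
    have key {R : Module.End ℝ E} (hR : IsOrderProjection R)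
        (hc : ∀ j z, R (P j z) = P j (R z)) :
        R x ≤ m • (∑ k ∈ Finset.range n, P k (R y) + P n (R y) - t • R y)⁺ := by
      refine (hR.monotone hxy).trans_eq ?_
      rw [map_smul, hR.map_posPart, map_sub, map_smul, map_sum, Finset.sum_range_succ]
      simp only [hc]
    have hc1 (j : ℕ) (z : E) : P n (P j z) = P j (P n z) := (hP n).apply_comm (hP j) z
    have hc0 (j : ℕ) (z : E) : (1 - P n) (P j z) = P j ((1 - P n) z) :=
      (hP n).one_sub.apply_comm (hP j) z
    have k1 := key (hP n) hc1
    have k0 := key (hP n).one_sub hc0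
    -- On the range of `P n` the last summand acts as `1`, so the threshold drops to `t - 1`, and
    -- the missing factor `exp θ` is the value of `1 + (exp θ - 1) P n` there. On the complement
    -- neither changes.
    have e1 : ∑ k ∈ Finset.range n, P k (P n y) + P n (P n y) - t • P n y
        = ∑ k ∈ Finset.range n, P k (P n y) - (t - 1) • P n y := by
      rw [(hP n).idem]
      module
    have e0 : P n ((1 - P n) y) = 0 := by simp [(hP n).idem]
    rw [e1] at k1
    rw [e0, add_zero] at k0
    have i1 := ih ((hP n).nonneg x hx) k1 ((hP n).nonneg y hy)
    have i0 := ih ((hP n).one_sub.nonneg x hx) k0 ((hP n).one_sub.nonneg y hy)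
    have i1' := smul_le_smul_of_nonneg_left i1 (Real.exp_pos θ).le
    rw [smul_smul, ← Real.exp_add, show θ + θ * (t - 1) = θ * t by ring] at i1'
    have hadd := add_le_add i1' i0
    have hl : Real.exp (θ * t) • P n x + Real.exp (θ * t) • (1 - P n) x
        = Real.exp (θ * t) • x := by
      simp only [LinearMap.sub_apply, Module.End.one_apply]
      module
    rw [hl] at hadd
    refine hadd.trans_eq ?_
    rw [prodOneAdd_succ_apply, apply_prodOneAdd_comm hP, LinearMap.sub_apply, Module.End.one_apply,
      map_sub]
    module

end prodOneAdd

/-! ### Band projections and spectral systems -/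

section bandProj

variable {u v x e : E}

theorem bandProj_of_nonneg (hx : 0 ≤ x) (hu : 0 ≤ u) :
    bandProj u x = ⨆ n : ℕ, x ⊓ (n : ℝ) • u := by
  have h (n : ℕ) : (0 : E) ⊓ (n : ℝ) • u = 0 :=
    inf_eq_left.2 (smul_nonneg (Nat.cast_nonneg n) hu)
  rw [bandProj, posPart_of_nonneg hx, negPart_of_nonneg hx, abs_of_nonneg hu]
  simp [h]

theorem bddAbove_range_inf (w : ℕ → E) (x : E) : BddAbove (Set.range fun n => x ⊓ w n) :=
  ⟨x, by rintro _ ⟨n, rfl⟩; exact inf_le_left⟩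

theorem bandProj_le (hx : 0 ≤ x) (hu : 0 ≤ u) : bandProj u x ≤ x := by
  rw [bandProj_of_nonneg hx hu]
  exact ciSup_le fun n => inf_le_left

theorem bandProj_nonneg (hx : 0 ≤ x) (hu : 0 ≤ u) : 0 ≤ bandProj u x := by
  rw [bandProj_of_nonneg hx hu]
  refine le_trans ?_ (le_ciSup (bddAbove_range_inf _ x) 0)
  simpa using hx

theorem bandProj_mono (hx : 0 ≤ x) (hu : 0 ≤ u) (huv : u ≤ v) : bandProj u x ≤ bandProj v x := by
  rw [bandProj_of_nonneg hx hu, bandProj_of_nonneg hx (hu.trans huv)]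
  exact ciSup_mono (bddAbove_range_inf _ x) fun n =>
    inf_le_inf_left x (smul_le_smul_of_nonneg_left huv (Nat.cast_nonneg n))

theorem bandProj_zero_left (hx : 0 ≤ x) : bandProj 0 x = 0 := by
  rw [bandProj_of_nonneg hx le_rfl]
  simp [hx]

theorem bandProj_eq_self {ε : ℝ} (hε : 0 < ε) (hx : 0 ≤ x) (hu : ε • x ≤ u) :
    bandProj u x = x := by
  have hu0 : 0 ≤ u := (smul_nonneg hε.le hx).trans hu
  refine le_antisymm (bandProj_le hx hu0) ?_
  obtain ⟨n, hn⟩ := exists_nat_ge ε⁻¹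
  rw [bandProj_of_nonneg hx hu0]
  refine le_trans (le_inf le_rfl ?_) (le_ciSup (bddAbove_range_inf _ x) n)
  calc x = (ε⁻¹ * ε) • x := by rw [inv_mul_cancel₀ hε.ne', one_smul]
    _ ≤ ((n : ℝ) * ε) • x :=
      smul_le_smul_of_nonneg_right (mul_le_mul_of_nonneg_right hn hε.le) hx
    _ = (n : ℝ) • ε • x := by rw [smul_smul]
    _ ≤ (n : ℝ) • u := smul_le_smul_of_nonneg_left hu (Nat.cast_nonneg n)

theorem spectralSystem_coe (e x : E) (r : ℝ) :
    spectralSystem e x r = e - bandProj (x - r • e)⁺ e := by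
  simp [spectralSystem]

@[simp] theorem spectralSystem_bot (e x : E) : spectralSystem e x ⊥ = 0 := by
  simp [spectralSystem]

@[simp] theorem spectralSystem_top (e x : E) : spectralSystem e x ⊤ = e := by
  simp [spectralSystem]

theorem spectralSystem_mono (he : 0 ≤ e) (x : E) : Monotone (spectralSystem e x) := by
  intro r s hrs
  induction r with
  | bot =>
    induction s with
    | bot => rfl
    | top => simpa using he
    | coe s => simpa [spectralSystem_coe] using bandProj_le he (posPart_nonneg _)
  | top => rw [top_le_iff.1 hrs]
  | coe r =>
    induction s with
    | bot => simp at hrs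
    | top => simpa [spectralSystem_coe] using bandProj_nonneg he (posPart_nonneg _)
    | coe s =>
      rw [spectralSystem_coe, spectralSystem_coe]
      refine sub_le_sub_left (bandProj_mono he (posPart_nonneg _) (posPart_mono ?_)) e
      exact sub_le_sub_left (smul_le_smul_of_nonneg_right (EReal.coe_le_coe_iff.1 hrs) he) x

theorem spectralSystem_eq_unit (he : 0 ≤ e) {r : ℝ} (hx : x ≤ r • e) :
    spectralSystem e x r = e := by
  rw [spectralSystem_coe, posPart_eq_zero.2 (sub_nonpos.2 hx), bandProj_zero_left he, sub_zero]

/-- The strict inequality matters: for `x = s e` the right continuous system already equals `e` at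
`s`. -/
theorem spectralSystem_eq_zero (he : 0 ≤ e) {r s : ℝ} (hrs : r < s) (hx : s • e ≤ x) :
    spectralSystem e x r = 0 := by
  rw [spectralSystem_coe, sub_eq_zero]
  refine (bandProj_eq_self (sub_pos.2 hrs) he (le_trans ?_ (le_posPart _))).symm
  rw [sub_smul]
  exact sub_le_sub_right hx _

theorem bandProj_le_exp_smul_prodOneAdd {P : ℕ → Module.End ℝ E}
    (hP : ∀ j, IsOrderProjection (P j)) (he : 0 ≤ e) {θ : ℝ} (hθ : 0 ≤ θ) (n : ℕ) (t : ℝ) :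
    bandProj (∑ k ∈ Finset.range n, P k e - t • e)⁺ e
      ≤ Real.exp (-(θ * t)) • prodOneAdd P (Real.exp θ - 1) n e := by
  have ha : 0 ≤ Real.exp θ - 1 := sub_nonneg.2 (Real.one_le_exp hθ)
  rw [bandProj_of_nonneg he (posPart_nonneg _)]
  -- The Markov bound applies to each `e ⊓ m u`, `u` being the positive part, and is independent of
  -- `m`.
  refine ciSup_le fun m => ?_
  have h := (exp_smul_le_prodOneAdd (t := t) (y := e) (m := m) hP hθ n
    (le_inf he (smul_nonneg (Nat.cast_nonneg m) (posPart_nonneg _))) inf_le_right he).trans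
    (monotone_of_nonneg (fun x hx => prodOneAdd_nonneg hP ha n hx) inf_le_left)
  have h' := smul_le_smul_of_nonneg_left h (Real.exp_pos (-(θ * t))).le
  rwa [smul_smul, ← Real.exp_add, neg_add_cancel, Real.exp_zero, one_smul] at h'

end bandProj

/-- The infimum is attained by the Archimedean property. If `e = 0`, every real is admissible and
the real `sInf` takes its default value `0`. -/
theorem abs_le_unitNorm_smul {e f : E} (he : 0 ≤ e) (hf : ∃ β : ℝ, |f| ≤ β • e)
    (hef : e = 0 → f = 0) :
    0 ≤ unitNorm e f ∧ |f| ≤ unitNorm e f • e := by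
  rcases eq_or_ne e 0 with h0 | h0
  · have h : unitNorm e f = 0 := by simp [unitNorm, h0, hef h0]
    rw [h]
    simp [hef h0]
  · have hnn (β : ℝ) (hβ : |f| ≤ β • e) : 0 ≤ β := by
      by_contra hlt
      have h1 := smul_nonneg (inv_nonneg.2 (neg_pos.2 (not_le.1 hlt)).le)
        ((abs_nonneg f).trans hβ)
      rw [smul_smul, show (-β)⁻¹ * β = -1 by
        have : β ≠ 0 := fun h => hlt h.ge
        field_simp] at h1
      exact h0 (le_antisymm (by simpa using h1) he)
    refine ⟨Real.sInf_nonneg hnn, le_of_forall_le_add_smul (e := e) fun ε hε => ?_⟩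
    obtain ⟨β, hβ, hlt⟩ := Real.lt_sInf_add_pos hf hε
    refine le_trans hβ ?_
    rw [← add_smul]
    exact smul_le_smul_of_nonneg_right hlt.le he

theorem IsWeakOrderUnit.eq_zero {e : E} (he : IsWeakOrderUnit e) (h0 : e = 0) (x : E) : x = 0 :=
  he.eq_zero_of_disjoint x (by rw [h0]; exact inf_eq_left.2 (abs_nonneg x))

/-! ### Expectation of products of independent projections -/

section Bernoulli

variable {e f : E} {T : Module.End ℝ E} {P : ℕ → Module.End ℝ E}

theorem list_prod_apply_le {ι : Type*} {P : ι → Module.End ℝ E} {b : ℝ}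
    (hT : ∀ x, 0 ≤ x → 0 ≤ T x) (hP : ∀ j x, 0 ≤ x → 0 ≤ P j x) (hb : 0 ≤ b)
    (hTP : ∀ j, T (P j e) ≤ b • e) (l : List ι) :
    (l.map fun i => T * P i).prod e ≤ b ^ l.length • e := by
  induction l with
  | nil => simp
  | cons i l ih =>
    simp only [List.map_cons, List.prod_cons, List.length_cons]
    have h := monotone_of_nonneg (A := T * P i) (fun x hx => hT _ (hP i x hx)) ih
    refine h.trans ?_
    rw [map_smul, pow_succ, mul_smul]
    exact smul_le_smul_of_nonneg_left (hTP i) (pow_nonneg hb _)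

/-- Expanding the factor `1 + a P n` leaves a stray `P n` in front, so the induction carries a list
of factors. Its indices are distinct and not yet used by the product, so independence applies once
the product is exhausted. -/
theorem apply_prodOneAdd_le {a b : ℝ} (hT : ∀ x, 0 ≤ x → 0 ≤ T x)
    (hP : ∀ j, IsOrderProjection (P j)) (hind : TIndependent e T P) (ha : 0 ≤ a) (hb : 0 ≤ b)
    (hTP : ∀ j, T (P j e) ≤ b • e) (n : ℕ) (l : List ℕ) (hl : l.Nodup) (hln : ∀ j ∈ l, n ≤ j) :
    T ((l.map P).prod (prodOneAdd P a n e)) ≤ (b ^ l.length * (1 + a * b) ^ n) • e := by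
  induction n generalizing l with
  | zero =>
    rw [prodOneAdd, Module.End.one_apply, hind l hl, pow_zero, mul_one]
    exact list_prod_apply_le hT (fun j => (hP j).nonneg) hb hTP l
  | succ n ih =>
    have hn : n ∉ l := fun h => absurd (hln n h) (by omega)
    have h1 := ih l hl fun j hj => (Nat.le_succ n).trans (hln j hj)
    have h2 := ih (l ++ [n]) (List.nodup_append'.2 ⟨hl, List.nodup_singleton n, by simpa using hn⟩)
      (by
        intro j hj
        rcases List.mem_append.1 hj with hj | hj
        · exact (Nat.le_succ n).trans (hln j hj)
        · exact (List.mem_singleton.1 hj).ge)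
    simp only [List.map_append, List.prod_append, List.map_singleton, List.prod_singleton,
      Module.End.mul_apply, List.length_append, List.length_singleton] at h2
    rw [prodOneAdd_succ_apply, map_add, map_add, map_smul, map_smul]
    refine (add_le_add h1 (smul_le_smul_of_nonneg_left h2 ha)).trans_eq ?_
    rw [smul_smul, ← add_smul]
    congr 1
    ring

end Bernoulli

end OrderedModule

end RieszSpace

/-! ### Step functions and dyadic approximation of the exponential -/

namespace DaniellStep

theorem eval_eq (φ : DaniellStep) {i : ℕ} (hi : i < φ.N) {s : ℝ} (h1 : φ.t i < s)
    (h2 : (s : EReal) ≤ φ.t (i + 1)) : φ.eval s = φ.c i := by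
  rw [eval, Finset.sum_eq_single i]
  · simp [h1, h2]
  · intro j _ hj
    refine if_neg fun ⟨h3, h4⟩ => ?_
    rcases lt_or_gt_of_ne hj with h | h
    · exact absurd (h4.trans (φ.mono h)) (not_le.2 h1)
    · exact absurd (h2.trans (φ.mono h)) (not_le.2 h3)
  · intro h
    exact absurd (Finset.mem_range.2 hi) h

theorem exists_index (φ : DaniellStep) (s : ℝ) :
    ∃ i < φ.N, φ.t i < s ∧ (s : EReal) ≤ φ.t (i + 1) := by
  classical
  have hex : ∃ j, (s : EReal) ≤ φ.t j := ⟨φ.N, by simp [φ.t_last]⟩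
  have h0 : Nat.find hex ≠ 0 := by
    intro h
    have := Nat.find_spec hex
    rw [h, φ.t_zero] at this
    simp at this
  obtain ⟨i, hi⟩ := Nat.exists_eq_succ_of_ne_zero h0
  have hspec := Nat.find_spec hex
  rw [hi] at hspec
  refine ⟨i, ?_, not_le.1 (Nat.find_min hex (by omega)), hspec⟩
  have : Nat.find hex ≤ φ.N := Nat.find_min' hex (by simp [φ.t_last])
  omega

/-- The step function with value `0` on `(-∞, r]` and `c` on `(r, ∞)`. -/
noncomputable def twoStep (r c : ℝ) : DaniellStep where
  N := 2
  t i := if i = 0 then ⊥ else if i = 1 then r else ⊤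
  c i := if i = 0 then 0 else c
  mono := monotone_nat_of_le_succ fun i => by rcases i with _ | _ | i <;> simp
  t_zero := by simp
  t_last := by simp

theorem eval_twoStep (r c s : ℝ) : (twoStep r c).eval s = if r < s then c else 0 := by
  simp [eval, twoStep, Finset.sum_range_succ]

/-- The step function whose value on each interval of the grid of mesh `2⁻ᵐ` of `(-m, m]` is the
value of the exponential at the left endpoint. -/
noncomputable def expGrid (m : ℕ) : DaniellStep where
  N := 2 * m * 2 ^ m + 2
  t i := if i = 0 then ⊥ else if i < 2 * m * 2 ^ m + 2 then
    ((-m + ((i : ℝ) - 1) / 2 ^ m : ℝ) : EReal) else ⊤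
  c i := if i = 0 then 0 else Real.exp (-m + ((i : ℝ) - 1) / 2 ^ m)
  mono := monotone_nat_of_le_succ fun i => by
    rcases i with _ | i
    · simp
    · by_cases h : i + 2 < 2 * m * 2 ^ m + 2
      · have h' : i + 1 < 2 * m * 2 ^ m + 2 := by omega
        rw [if_neg i.succ_ne_zero, if_neg (i + 1).succ_ne_zero, if_pos h, if_pos h', EReal.coe_le_coe_iff]
        push_cast
        gcongr
        linarith
      · rw [if_neg (i + 1).succ_ne_zero, if_neg h]
        exact le_top
  t_zero := by simp
  t_last := by simp

theorem expGrid_t {m i : ℕ} (h0 : i ≠ 0) (hi : i < 2 * m * 2 ^ m + 2) :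
    (expGrid m).t i = ((-m + ((i : ℝ) - 1) / 2 ^ m : ℝ) : EReal) := by
  simp [expGrid, h0, hi]

theorem expGrid_c {m i : ℕ} (h0 : i ≠ 0) :
    (expGrid m).c i = Real.exp (-m + ((i : ℝ) - 1) / 2 ^ m) := by
  simp [expGrid, h0]

theorem expGrid_c_zero (m : ℕ) : (expGrid m).c 0 = 0 := by
  simp [expGrid]

theorem expGrid_c_nonneg (m i : ℕ) : 0 ≤ (expGrid m).c i := by
  by_cases h0 : i = 0
  · simp [h0, expGrid_c_zero]
  · rw [expGrid_c h0]
    positivity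

theorem expGrid_c_mono (m : ℕ) : Monotone (expGrid m).c := by
  intro i j hij
  by_cases h0 : i = 0
  · rw [h0, expGrid_c_zero]
    exact expGrid_c_nonneg m j
  · rw [expGrid_c h0, expGrid_c (by omega)]
    gcongr

/-- The value of `expGrid m` at `s` is the greatest of the values at grid points below `s`. -/
theorem le_eval_expGrid {m j : ℕ} {s : ℝ} (h : (expGrid m).t j < s) :
    (expGrid m).c j ≤ (expGrid m).eval s := by
  obtain ⟨i, hi, h1, h2⟩ := (expGrid m).exists_index s
  rw [eval_eq _ hi h1 h2]
  refine expGrid_c_mono m ?_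
  by_contra hlt
  exact absurd (h2.trans ((expGrid m).mono (not_le.1 hlt))) (not_le.2 h)

theorem eval_expGrid_le_exp (m : ℕ) (s : ℝ) : (expGrid m).eval s ≤ Real.exp s := by
  obtain ⟨i, hi, h1, h2⟩ := (expGrid m).exists_index s
  rw [eval_eq _ hi h1 h2]
  by_cases h0 : i = 0
  · rw [h0, expGrid_c_zero]
    positivity
  · rw [expGrid_c h0]
    rw [expGrid_t h0 hi, EReal.coe_lt_coe_iff] at h1
    exact Real.exp_le_exp.2 h1.le

theorem eval_expGrid_mono (s : ℝ) : Monotone fun m => (expGrid m).eval s := by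
  refine monotone_nat_of_le_succ fun m => ?_
  obtain ⟨i, hi, h1, h2⟩ := (expGrid m).exists_index s
  rw [eval_eq _ hi h1 h2]
  by_cases h0 : i = 0
  · rw [h0, expGrid_c_zero, ← expGrid_c_zero (m + 1)]
    exact le_eval_expGrid (by rw [t_zero]; exact EReal.bot_lt_coe s)
  · obtain ⟨k, rfl⟩ := Nat.exists_eq_succ_of_ne_zero h0
    have hk : k < 2 * m * 2 ^ m + 1 := by
      change k + 1 < 2 * m * 2 ^ m + 2 at hi
      omega
    -- The index `2k + 2^(m+1) + 1` marks, on the finer grid, the same point as `k + 1` on the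
    -- coarser one; the shift by `2^(m+1)` accounts for starting at `-(m+1)`.
    have hj : 2 * k + 2 ^ (m + 1) + 1 < 2 * (m + 1) * 2 ^ (m + 1) + 2 := by
      have h2m : 1 ≤ 2 ^ m := Nat.one_le_two_pow
      rw [pow_succ]
      nlinarith
    have hpt : (-((m + 1 : ℕ) : ℝ) + (((2 * k + 2 ^ (m + 1) + 1 : ℕ) : ℝ) - 1) / 2 ^ (m + 1))
        = -m + (((k + 1 : ℕ) : ℝ) - 1) / 2 ^ m := by
      push_cast
      field_simp
      ring
    rw [expGrid_t h0 hi] at h1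
    rw [expGrid_c h0, ← hpt, ← expGrid_c (Nat.succ_ne_zero _)]
    refine le_eval_expGrid ?_
    rw [expGrid_t (Nat.succ_ne_zero _) hj, hpt]
    exact h1

theorem exp_sub_le_eval_expGrid {m : ℕ} {s : ℝ} (hs : |s| < m) :
    Real.exp (s - 1 / 2 ^ m) ≤ (expGrid m).eval s := by
  obtain ⟨i, hi, h1, h2⟩ := (expGrid m).exists_index s
  rw [eval_eq _ hi h1 h2]
  obtain ⟨hs1, hs2⟩ := abs_lt.1 hs
  change i < 2 * m * 2 ^ m + 2 at hi
  -- As `-m < s < m`, neither unbounded interval contains `s`.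
  have hi' : i + 1 < 2 * m * 2 ^ m + 2 := by
    by_contra hlt
    have hie : i = 2 * m * 2 ^ m + 1 := by omega
    rw [expGrid_t (by omega) hi, EReal.coe_lt_coe_iff, hie] at h1
    push_cast at h1
    have : -(m : ℝ) + (2 * m * 2 ^ m + 1 - 1) / 2 ^ m = m := by
      field_simp
      ring
    linarith
  rw [expGrid_t (Nat.succ_ne_zero i) hi', EReal.coe_le_coe_iff] at h2
  have h0 : i ≠ 0 := by
    rintro rfl
    simp at h2
    linarith
  rw [expGrid_c h0]
  refine Real.exp_le_exp.2 ?_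
  push_cast at h2
  have : -(m : ℝ) + ((i : ℝ) + 1 - 1) / 2 ^ m = -m + ((i : ℝ) - 1) / 2 ^ m + 1 / 2 ^ m := by ring
  linarith

end DaniellStep

/-! ### Existence and lower bound of the exponential -/

namespace RieszSpace

theorem isUpperLimit_exp : IsUpperLimit Real.exp := by
  refine ⟨DaniellStep.expGrid, DaniellStep.eval_expGrid_mono, fun s => ?_⟩
  have hlim : Filter.Tendsto (fun m : ℕ => Real.exp (s - 1 / 2 ^ m)) Filter.atTop
      (𝓝 (Real.exp s)) := by
    have h0 : Filter.Tendsto (fun m : ℕ => (1 : ℝ) / 2 ^ m) Filter.atTop (𝓝 0) := by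
      simpa using tendsto_pow_atTop_nhds_zero_of_lt_one (r := (2 : ℝ)⁻¹) (by norm_num) (by norm_num)
    have h1 := (Real.continuous_exp.tendsto (s - 0)).comp (h0.const_sub s)
    simpa [Function.comp_def] using h1
  refine tendsto_of_tendsto_of_tendsto_of_le_of_le' hlim tendsto_const_nhds ?_
    (Filter.Eventually.of_forall fun m => DaniellStep.eval_expGrid_le_exp m s)
  filter_upwards [(tendsto_natCast_atTop_atTop (R := ℝ)).eventually_gt_atTop |s|] with m hm
  exact DaniellStep.exp_sub_le_eval_expGrid hm

variable {E : Type*} [AddCommGroup E] [Module ℝ E] [ConditionallyCompleteLattice E]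
  [IsOrderedAddMonoid E] [IsOrderedModule ℝ E] {e x : E}

/-- Intervals starting at or beyond `r` have measure zero; any other nonempty one contains a point
`s ≤ r`, where the coefficient is at most `exp s ≤ exp r`. -/
theorem integral_le_exp_smul (he : 0 ≤ e) {r : ℝ} (hx : x ≤ r • e) {φ : DaniellStep}
    (hφ : ∀ s, φ.eval s ≤ Real.exp s) : φ.integral e x ≤ Real.exp r • e := by
  have hterm : ∀ i ∈ Finset.range φ.N,
      φ.c i • (spectralSystem e x (φ.t (i + 1)) - spectralSystem e x (φ.t i))
        ≤ Real.exp r • (spectralSystem e x (φ.t (i + 1)) - spectralSystem e x (φ.t i)) := by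
    intro i hi
    have hmono := spectralSystem_mono he x
    have htop : spectralSystem e x r = e := spectralSystem_eq_unit he hx
    have hle (s : EReal) : spectralSystem e x s ≤ e := by
      simpa using hmono (le_top : s ≤ ⊤)
    rcases (φ.mono (Nat.le_succ i)).eq_or_lt with heq | hlt
    · rw [← Nat.succ_eq_add_one, ← heq]
      simp
    rcases le_or_gt (r : EReal) (φ.t i) with hr | hr
    · have h1 : spectralSystem e x (φ.t i) = e := le_antisymm (hle _) (htop.ge.trans (hmono hr))
      have h2 : spectralSystem e x (φ.t (i + 1)) = e :=
        le_antisymm (hle _) (h1.ge.trans (hmono hlt.le))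
      simp [h1, h2]
    · refine smul_le_smul_of_nonneg_right ?_ (sub_nonneg.2 (hmono hlt.le))
      obtain ⟨s, hs⟩ : ∃ s : ℝ, (s : EReal) = min (φ.t (i + 1)) r :=
        ⟨_, EReal.coe_toReal (ne_top_of_le_ne_top (EReal.coe_ne_top r) (min_le_right _ _))
          (ne_bot_of_gt (lt_min hlt hr))⟩
      rw [← φ.eval_eq (Finset.mem_range.1 hi) (s := s) (hs ▸ lt_min hlt hr)
        (hs ▸ min_le_left _ _)]
      exact (hφ s).trans (Real.exp_le_exp.2 (EReal.coe_le_coe_iff.1 (hs ▸ min_le_right _ _)))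
  refine (Finset.sum_le_sum hterm).trans_eq ?_
  rw [← Finset.smul_sum, Finset.sum_range_sub (fun i => spectralSystem e x (φ.t i)), φ.t_last,
    φ.t_zero, spectralSystem_top, spectralSystem_bot, sub_zero]

theorem integral_twoStep (he : 0 ≤ e) {r s : ℝ} (hrs : r < s) (hx : s • e ≤ x) (c : ℝ) :
    (DaniellStep.twoStep r c).integral e x = c • e := by
  simp [DaniellStep.integral, DaniellStep.twoStep, Finset.sum_range_succ,
    spectralSystem_eq_zero he hrs hx]

/-- If `r e ≤ x ≤ s e`, then `exp x` exists and `exp(r) e ≤ exp x`. -/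
theorem exists_isFunctionalCalculus_exp (he : 0 ≤ e) {r s : ℝ} (hr : r • e ≤ x) (hs : x ≤ s • e) :
    ∃ y, IsFunctionalCalculus e x Real.exp y ∧ Real.exp r • e ≤ y := by
  set S := {z : E | ∃ φ : DaniellStep, (∀ s, φ.eval s ≤ Real.exp s) ∧ φ.integral e x = z} with hS
  -- The step function equal to `exp q` beyond `q < r` lies below the exponential and integrates to
  -- `exp q • e`; then `q` tends to `r`.
  have hmem {q : ℝ} (hq : q < r) : Real.exp q • e ∈ S := by
    refine ⟨DaniellStep.twoStep q (Real.exp q), fun s => ?_, integral_twoStep he hq hr _⟩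
    rw [DaniellStep.eval_twoStep]
    split_ifs with h
    · exact Real.exp_le_exp.2 h.le
    · positivity
  have hlub : IsLUB S (sSup S) := by
    refine isLUB_csSup ⟨_, hmem (sub_one_lt r)⟩ ⟨Real.exp s • e, ?_⟩
    rintro _ ⟨φ, hφ, rfl⟩
    exact integral_le_exp_smul he hs hφ
  refine ⟨sSup S, ⟨isUpperLimit_exp, hlub⟩, le_of_forall_le_add_smul (e := e) fun ε hε => ?_⟩
  have hev : ∀ᶠ q in 𝓝[<] r, Real.exp r - ε < Real.exp q :=
    nhdsWithin_le_nhds ((Real.continuous_exp.tendsto r).eventually_const_lt (by linarith))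
  obtain ⟨q, hq1, hq2⟩ := (hev.and self_mem_nhdsWithin).exists
  calc Real.exp r • e ≤ (Real.exp q + ε) • e :=
        smul_le_smul_of_nonneg_right (by linarith) he
    _ = Real.exp q • e + ε • e := add_smul _ _ _
    _ ≤ sSup S + ε • e := add_le_add_left (hlub.1 (hmem hq2)) _

/-! ### Chernoff bound and conclusion -/

/-- The Chernoff bound for a Bernoulli process whose expectation is at most `b e`. -/
theorem chernoff_bound {T : Module.End ℝ E} {P : ℕ → Module.End ℝ E}
    (hT : ∀ x, 0 ≤ x → 0 ≤ T x) (he : 0 ≤ e)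
    (hP : ∀ j, IsOrderProjection (P j)) (hind : TIndependent e T P) {b : ℝ} (hb : 0 ≤ b)
    (hTP : ∀ j, T (P j e) ≤ b • e) (n : ℕ) (t : ℝ) {θ : ℝ} (hθ : 0 ≤ θ) :
    T (bandProj (∑ k ∈ Finset.range n, P k e - t • e)⁺ e)
      ≤ Real.exp (n * b * (Real.exp θ - 1) - θ * t) • e := by
  have ha : 0 ≤ Real.exp θ - 1 := sub_nonneg.2 (Real.one_le_exp hθ)
  have h1 := monotone_of_nonneg hT (bandProj_le_exp_smul_prodOneAdd hP he hθ n t)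
  have h2 := apply_prodOneAdd_le hT hP hind ha hb hTP n [] List.nodup_nil (by simp)
  simp only [List.map_nil, List.prod_nil, Module.End.one_apply, List.length_nil, pow_zero,
    one_mul] at h2
  rw [map_smul] at h1
  refine h1.trans ((smul_le_smul_of_nonneg_left h2 (Real.exp_pos _).le).trans ?_)
  rw [smul_smul]
  refine smul_le_smul_of_nonneg_right ?_ he
  have h3 : (1 + (Real.exp θ - 1) * b) ^ n ≤ Real.exp (n * ((Real.exp θ - 1) * b)) := by
    rw [Real.exp_nat_mul]
    have := Real.add_one_le_exp ((Real.exp θ - 1) * b)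
    exact pow_le_pow_left₀ (by positivity) (by linarith) n
  calc _ ≤ Real.exp (-(θ * t)) * Real.exp (n * ((Real.exp θ - 1) * b)) := by gcongr
    _ = _ := by rw [← Real.exp_add]; ring_nf

end RieszSpace

open RieszSpace in
theorem mainTheorem4 {E : Type*} [AddCommGroup E] [Module ℝ E] [ConditionallyCompleteLattice E]
    [IsOrderedAddMonoid E] [IsOrderedModule ℝ E]
    (e : E) (T : Module.End ℝ E) (hT : IsConditionalTriple e T)
    (P : ℕ → Module.End ℝ E) (f : E) (hP : IsBernoulliProcess e T P f)
    (n : ℕ) (t : ℝ) (ht : (n : ℝ) * unitNorm e f < t) :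
    ∃ expNegNF : E, IsFunctionalCalculus e (-((n : ℝ) • f)) Real.exp expNegNF ∧
      T (bandProj ((∑ k ∈ Finset.range n, P k e) - t • e)⁺ e) ≤
        ((n : ℝ) * unitNorm e f * Real.exp 1 / t) ^ t • expNegNF := by
  have he : 0 ≤ e := hT.weakUnit.nonneg
  have hproj (j : ℕ) : IsOrderProjection (P j) := (hP.bandProjection j).isOrderProjection
  have hf0 : 0 ≤ f := hP.expectation 0 ▸ hT.positive _ ((hproj 0).nonneg e he)
  have hfe : f ≤ e := by
    rw [← hP.expectation 0]
    exact (monotone_of_nonneg hT.positive ((hproj 0).le_self e he)).trans_eq hT.map_unit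
  obtain ⟨hb, hfb⟩ := abs_le_unitNorm_smul (f := f) he
    ⟨1, by rwa [abs_of_nonneg hf0, one_smul]⟩ fun h => hT.weakUnit.eq_zero h f
  rw [abs_of_nonneg hf0] at hfb
  set b := unitNorm e f
  have hn : (0 : ℝ) ≤ n := Nat.cast_nonneg n
  have hlow : (-(n * b)) • e ≤ -((n : ℝ) • f) := by
    rw [neg_smul, mul_smul]
    exact neg_le_neg (smul_le_smul_of_nonneg_left hfb hn)
  have hupp : -((n : ℝ) • f) ≤ (0 : ℝ) • e := by
    rw [zero_smul]
    exact neg_nonpos.2 (smul_nonneg hn hf0)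
  obtain ⟨y, hy, hyl⟩ := exists_isFunctionalCalculus_exp he hlow hupp
  refine ⟨y, hy, ?_⟩
  have hnb : 0 ≤ n * b := mul_nonneg hn hb
  have ht0 : 0 < t := hnb.trans_lt ht
  have hch {θ : ℝ} (hθ : 0 ≤ θ) := chernoff_bound hT.positive he hproj hP.independent
    hb (fun j => (hP.expectation j).trans_le hfb) n t hθ
  rcases hnb.eq_or_lt with h0 | h0
  · rw [← h0, zero_mul, zero_div, Real.zero_rpow ht0.ne', zero_smul]
    refine nonpos_of_forall_le_smul (e := e) fun ε hε => ?_
    -- When `nb = 0` there is no finite optimal `θ`; this choice makes the bound `exp(-θt)` at most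
    -- `ε`.
    have hθ : 0 ≤ |Real.log ε| / t := by positivity
    refine (hch hθ).trans (smul_le_smul_of_nonneg_right ?_ he)
    rw [← h0, zero_mul, zero_sub, div_mul_cancel₀ _ ht0.ne']
    exact (Real.exp_le_exp.2 (neg_abs_le _)).trans_eq (Real.exp_log hε)
  -- This `θ` minimises `nb(exp θ - 1) - θt`; it is nonnegative because `t > nb`.
  · have hθ : 0 ≤ Real.log (t / (n * b)) := Real.log_nonneg ((one_le_div h0).2 ht.le)
    refine (hch hθ).trans ?_
    have hq : 0 < t / (n * b) := div_pos ht0 h0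
    have hC : Real.exp (n * b * (Real.exp (Real.log (t / (n * b))) - 1)
        - Real.log (t / (n * b)) * t)
        = ((n : ℝ) * b * Real.exp 1 / t) ^ t * Real.exp (-(n * b)) := by
      rw [Real.rpow_def_of_pos (by positivity), ← Real.exp_add, Real.exp_log hq,
        Real.log_div (by positivity) ht0.ne', Real.log_mul h0.ne' (Real.exp_pos 1).ne',
        Real.log_exp, Real.log_div ht0.ne' h0.ne', mul_sub, mul_div_cancel₀ _ h0.ne']
      congr 1
      ring
    rw [hC, mul_smul]
    exact smul_le_smul_of_nonneg_left hyl (Real.rpow_nonneg (by positivity) _)
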